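/- Let $m,n\ge 0$ be integers and let $s>m$ be real. Let $\Lambda$ be a compact metric space and $\omega$ a finite non-zero Borel measure on $\Lambda$. For each $\lambda\in\Lambda$ let $P_\lambda:\mathbb{R}^n\to\mathbb{R}^m$ be an orthogonal projection (that is, the orthogonal projection of $\mathbb{R}^n$ onto an $m$-dimensional linear subspace $V_\lambda$, followed by a linear isometry of $V_\lambda$ onto $\mathbb{R}^m$), and suppose that $\lambda\mapsto P_\lambda x$ is continuous for every $x\in\mathbb{R}^n$. Write $B(x,r)$ for the closed ball in $\mathbb{R}^n$ with centre $x$ and radius $r$, $\mathcal L^m$ for Lebesgue measure on $\mathbb{R}^m$, $\mathcal H^s$ for $s$-dimensional Hausdorff measure, $\dim$ for Hausdorff dimension, $P_{\lambda\sharp}\mu$ for the push-forward of $\mu$ under $P_\lambda$, and $D(\nu,\cdot)$ for the Radon–Nikodym derivative with respect to $\mathcal L^m$ of a measure $\nu$ on $\mathbb{R}^m$. Suppose that there is a constant $C>0$ such that, for every Borel measure $\mu$ on $\mathbb{R}^n$ with compact support contained in $B(0,1)$, with $0<\mu(B(0,1))<\infty$ and with $\mu(B(x,r))\le r^s$ for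 all $x\in\mathbb{R}^n$ and $r>0$, one has $P_{\lambda\sharp}\mu\ll\mathcal L^m$ for $\omega$-almost all $\lambda\in\Lambda$ and $$\iint D(P_{\lambda\sharp}\mu,u)^2\,d\mathcal L^m u\,d\omega\lambda < C\,\mu(B(0,1)).$$ Then for every $\mathcal H^s$-measurable set $A\subset\mathbb{R}^n$ with $0<\mathcal H^s(A)<\infty$, and for $\omega$-almost all $\lambda\in\Lambda$, $$\mathcal L^m\bigl(\{u\in\mathbb{R}^m:\dim (P_\lambda^{-1}\{u\}\cap A)=s-m\}\bigr)>0.$$ -/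

import Mathlib

open MeasureTheory MeasureTheory.Measure

/-- Euclidean space `ℝⁿ` with the Euclidean norm. -/
abbrev Eucl (n : ℕ) : Type := EuclideanSpace ℝ (Fin n)

/-- `P : ℝⁿ → ℝᵐ` is an orthogonal projection: the orthogonal projection onto an `m`-dimensional
linear subspace `V` of `ℝⁿ`, followed by an isometric linear identification of `V` with `ℝᵐ`. -/
def IsOrthProj {n m : ℕ} (P : Eucl n → Eucl m) : Prop :=
  ∃ (V : Submodule ℝ (Eucl n)) (e : V ≃ₗᵢ[ℝ] Eucl m), ∀ x, P x = e (V.orthogonalProjectionOnto x)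

/-- `μ ∈ 𝓜(A)`: a Borel measure with `0 < μ(A) < ∞` whose support is compact and contained
in `A`. -/
def MemM {n : ℕ} (A : Set (Eucl n)) (μ : Measure (Eucl n)) : Prop :=
  0 < μ A ∧ μ A < ⊤ ∧ IsCompact μ.support ∧ μ.support ⊆ A

/-- The Frostman condition `μ(B(x,r)) ≤ r^s` for all `x ∈ ℝⁿ` and `r > 0`. -/
def IsFrostman {n : ℕ} (s : ℝ) (μ : Measure (Eucl n)) : Prop :=
  ∀ (x : Eucl n) (r : ℝ), 0 < r → μ (Metric.closedBall x r) ≤ ENNReal.ofReal (r ^ s)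

/-! The dimension of almost every fibre is bounded from both sides. Upper bound: an Eilenberg-type
inequality (`ae_hausdorffMeasure_fiber_ne_top`) makes the `(s - m)`-dimensional measure of
Lebesgue-almost every fibre of `A` finite.

Lower bound: `A` contains a Borel set `F` carrying a Frostman measure `μ`
(`exists_isFrostman_of_isCaratheodory`). Rescaled to a ball of radius `r`, the `L²` hypothesis gains
a factor `r ^ (s - m)` (`lintegral_rnDeriv_sq_le_of_closedBall`). Apply this to `μ` restricted to
the dyadic cubes of side `2⁻ᵏ` and sum over cubes with weights `2 ^ (k * t)`, where `t < s - m`: the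
masses add up to `μ univ`, and what remains is a convergent geometric series
(`ae_absolutelyContinuous_and_energy`). For fixed `λ`, disintegrate `μ` along `P_λ` into conditional
measures `μ_u`, and let `h` be the density of the push-forward. The restriction of `μ` to a cube `Q`
projects to density `h u * μ_u Q`, so the weighted sum equals `∫ h² * dyadicEnergy t μ_u`. Its
finiteness gives `μ_u` finite energy, and hence its fibre dimension at least `t`, for almost every
`u` with respect to the push-forward (`ae_le_dimH_fiber`). That push-forward is non-zero and
absolutely continuous, so the good `u` cannot form a Lebesgue-null set. -/

open Filter Set Metric
open scoped ENNReal NNReal Topology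

/-! ### Dyadic cubes. -/

/-- The index of the half-open dyadic cube of side `2⁻ᵏ` that contains `x`. -/
noncomputable def dyadicIndex {n : ℕ} (k : ℕ) (x : Eucl n) : Fin n → ℤ :=
  fun i => ⌊(2 : ℝ) ^ k * x i⌋

/-- The half-open dyadic cube of side `2⁻ᵏ` and index `z`. -/
def dyadicCube {n : ℕ} (k : ℕ) (z : Fin n → ℤ) : Set (Eucl n) := dyadicIndex k ⁻¹' {z}

lemma measurable_dyadicIndex {n : ℕ} (k : ℕ) : Measurable (dyadicIndex (n := n) k) := by
  unfold dyadicIndex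
  refine measurable_pi_lambda _ fun i => Int.measurable_floor.comp ?_
  fun_prop

lemma measurableSet_dyadicCube {n : ℕ} (k : ℕ) (z : Fin n → ℤ) :
    MeasurableSet (dyadicCube k z) :=
  measurable_dyadicIndex k (measurableSet_singleton z)

lemma iUnion_dyadicCube {n : ℕ} (k : ℕ) : ⋃ z : Fin n → ℤ, dyadicCube k z = univ := by
  ext x; simp [dyadicCube]

lemma pairwise_disjoint_dyadicCube {n : ℕ} (k : ℕ) :
    Pairwise (Function.onFun Disjoint fun z : Fin n → ℤ => dyadicCube k z) := by
  intro z w hzw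
  exact Disjoint.preimage _ (by simpa using hzw)

/-- The crude factor `n + 1` in place of `√n` keeps the radius positive even for `n = 0`. -/
lemma dyadicCube_subset_closedBall {n : ℕ} {k : ℕ} {z : Fin n → ℤ} {x : Eucl n}
    (hx : x ∈ dyadicCube k z) : dyadicCube k z ⊆ closedBall x ((n + 1) * ((1 : ℝ) / 2) ^ k) := by
  intro y hy
  have hi : ∀ i, dist (y i) (x i) ^ 2 ≤ (((1 : ℝ) / 2) ^ k) ^ 2 := by
    intro i
    have e : ⌊(2 : ℝ) ^ k * y i⌋ = ⌊(2 : ℝ) ^ k * x i⌋ := by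
      have h1 : dyadicIndex k y = z := hy
      have h2 : dyadicIndex k x = z := hx
      exact congrFun (h1.trans h2.symm) i
    have h := Int.abs_sub_lt_one_of_floor_eq_floor e
    rw [← mul_sub, abs_mul, abs_of_pos (by positivity)] at h
    refine pow_le_pow_left₀ dist_nonneg ?_ 2
    rw [Real.dist_eq, one_div, inv_pow, ← one_div, le_div_iff₀' (by positivity)]
    exact h.le
  rw [mem_closedBall, EuclideanSpace.dist_eq]
  refine Real.sqrt_le_iff.2 ⟨by positivity, (Finset.sum_le_sum fun i _ => hi i).trans ?_⟩
  rw [Finset.sum_const, Finset.card_univ, Fintype.card_fin, nsmul_eq_mul, mul_pow]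
  gcongr
  nlinarith [(Nat.cast_nonneg n : (0 : ℝ) ≤ n)]

/-- A set of diameter at most `2⁻ᵏ` meets only the `3 ^ n` cubes around the one containing a given
point of it; those missing `G` do not count. -/
lemma measure_inter_le_of_ediam_le {n : ℕ} (ν : Measure (Eucl n)) {G U : Set (Eucl n)} {k : ℕ}
    {c : ℝ≥0∞} (hG : ∀ x ∈ G, ν (dyadicCube k (dyadicIndex k x)) ≤ c) {d : ℝ}
    (hd : d ≤ (1 / 2) ^ k) (hU : ediam U ≤ ENNReal.ofReal d) : ν (U ∩ G) ≤ 3 ^ n * c := by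
  rcases (U ∩ G).eq_empty_or_nonempty with h | ⟨x, hxU, -⟩
  · simp [h]
  let z : (Fin n → Fin 3) → Fin n → ℤ := fun δ i => dyadicIndex k x i + (δ i : ℤ) - 1
  have hsub : U ∩ G ⊆ ⋃ δ, (G ∩ dyadicCube k (z δ)) := by
    rintro y ⟨hyU, hyG⟩
    have hi : ∀ i, ∃ a : Fin 3, dyadicIndex k y i = dyadicIndex k x i + (a : ℤ) - 1 := by
      intro i
      have h1 : dist y x ≤ (1 / 2) ^ k := by
        have := (edist_le_ediam_of_mem hyU hxU).trans (hU.trans (ENNReal.ofReal_le_ofReal hd))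
        rwa [edist_dist, ENNReal.ofReal_le_ofReal_iff (by positivity)] at this
      have h2 : |y i - x i| ≤ (1 / 2) ^ k := by
        have := (PiLp.norm_apply_le (y - x) i)
        rw [← dist_eq_norm] at this
        exact (by simpa using this : |y i - x i| ≤ dist y x).trans h1
      have h3 : |(2 : ℝ) ^ k * y i - (2 : ℝ) ^ k * x i| ≤ 1 := by
        rw [← mul_sub, abs_mul, abs_of_pos (by positivity)]
        rwa [one_div, inv_pow, ← one_div, le_div_iff₀' (by positivity)] at h2
      have h4 := abs_le.1 h3
      have a1 : ⌊(2 : ℝ) ^ k * y i⌋ ≤ ⌊(2 : ℝ) ^ k * x i⌋ + 1 := by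
        rw [← Int.floor_add_one]; exact Int.floor_le_floor (by linarith)
      have a2 : ⌊(2 : ℝ) ^ k * x i⌋ ≤ ⌊(2 : ℝ) ^ k * y i⌋ + 1 := by
        rw [← Int.floor_add_one]; exact Int.floor_le_floor (by linarith)
      change ∃ a : Fin 3, ⌊(2 : ℝ) ^ k * y i⌋ = ⌊(2 : ℝ) ^ k * x i⌋ + (a : ℤ) - 1
      -- The index differences `-1, 0, 1` are shifted by one to lie in `Fin 3`.
      refine ⟨⟨(⌊(2 : ℝ) ^ k * y i⌋ - ⌊(2 : ℝ) ^ k * x i⌋ + 1).toNat, by omega⟩, ?_⟩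
      simp only
      omega
    choose δ hδ using hi
    exact mem_iUnion.2 ⟨δ, hyG, funext hδ⟩
  have hz : ∀ w, ν (G ∩ dyadicCube k w) ≤ c := by
    intro w
    rcases (G ∩ dyadicCube k w).eq_empty_or_nonempty with h | ⟨y, hyG, hy⟩
    · simp [h]
    · have : dyadicIndex k y = w := hy
      exact (measure_mono inter_subset_right).trans (this ▸ hG y hyG)
  calc ν (U ∩ G) ≤ ∑ δ, ν (G ∩ dyadicCube k (z δ)) :=
        (measure_mono hsub).trans (measure_iUnion_fintype_le _ _)
    _ ≤ ∑ _δ : Fin n → Fin 3, c := Finset.sum_le_sum fun δ _ => hz _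
    _ = 3 ^ n * c := by simp

/-! ### Finite dyadic energy and lower bounds for dimension. -/

/-- The discrete dyadic version of the `t`-energy of a measure. -/
noncomputable def dyadicEnergy {n : ℕ} (t : ℝ) (ν : Measure (Eucl n)) : ℝ≥0∞ :=
  ∑' k : ℕ, (2 : ℝ≥0∞) ^ (k * t) * ∑' z : Fin n → ℤ, ν (dyadicCube k z) ^ 2

lemma lintegral_dyadic_eq_energy {n : ℕ} (t : ℝ) (ν : Measure (Eucl n)) :
    ∫⁻ x, ∑' k : ℕ, (2 : ℝ≥0∞) ^ (k * t) * ν (dyadicCube k (dyadicIndex k x)) ∂ν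
      = dyadicEnergy t ν := by
  have hm : ∀ k : ℕ, Measurable fun x : Eucl n => ν (dyadicCube k (dyadicIndex k x)) := fun k =>
    (measurable_of_countable fun z => ν (dyadicCube k z)).comp (measurable_dyadicIndex k)
  rw [lintegral_tsum fun k => ((hm k).const_mul _).aemeasurable]
  refine tsum_congr fun k => ?_
  rw [lintegral_const_mul _ (hm k), ← lintegral_map (f := fun z => ν (dyadicCube k z))
    (measurable_of_countable _) (measurable_dyadicIndex k), lintegral_countable']
  congr 1
  refine tsum_congr fun z => ?_
  rw [map_apply (measurable_dyadicIndex k) (measurableSet_singleton z), sq]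
  rfl

lemma measure_inter_le_of_dyadic_bound {n : ℕ} {t : ℝ} (ht : 0 < t) (ν : Measure (Eucl n))
    {G U : Set (Eucl n)} {M : ℝ≥0}
    (hG : ∀ x ∈ G, ∀ k : ℕ, (2 : ℝ≥0∞) ^ (k * t) * ν (dyadicCube k (dyadicIndex k x)) ≤ M)
    (hU : ediam U ≤ 1) : ν (U ∩ G) ≤ (3 ^ n * M * 2 ^ t) * ediam U ^ t := by
  have key : ∀ d : ℝ, 0 < d → d ≤ 1 → ediam U ≤ ENNReal.ofReal d →
      ν (U ∩ G) ≤ (3 ^ n * M * 2 ^ t) * ENNReal.ofReal d ^ t := by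
    intro d h0 h1 hd
    -- The scale satisfies `2⁻⁽ᵏ⁺¹⁾ < d ≤ 2⁻ᵏ`; replacing `2⁻ᵏ` by `d` costs the factor `2 ^ t`.
    obtain ⟨k, hk1, hk2⟩ := exists_nat_pow_near_of_lt_one h0 h1
      (by norm_num : (0 : ℝ) < 1 / 2) (by norm_num)
    have hpos : (2 : ℝ≥0∞) ^ (k * t) ≠ 0 := by positivity
    have htop : (2 : ℝ≥0∞) ^ (k * t) ≠ ⊤ := by simp
    have hc : ∀ x ∈ G, ν (dyadicCube k (dyadicIndex k x)) ≤ M * ((2 : ℝ≥0∞) ^ (k * t))⁻¹ := by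
      intro x hx
      rw [← div_eq_mul_inv, ENNReal.le_div_iff_mul_le (Or.inl hpos) (Or.inl htop), mul_comm]
      exact hG x hx k
    refine (measure_inter_le_of_ediam_le ν hc hk2 hd).trans ?_
    have e : ((2 : ℝ≥0∞) ^ (k * t))⁻¹ = 2 ^ t * (ENNReal.ofReal ((1 / 2) ^ (k + 1))) ^ t := by
      rw [ENNReal.ofReal_pow (by norm_num), one_div, ENNReal.ofReal_inv_of_pos (by norm_num),
        ← ENNReal.mul_rpow_of_nonneg _ _ ht.le, ENNReal.rpow_mul, ← ENNReal.inv_rpow]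
      congr 1
      simp only [ENNReal.ofReal_ofNat, ENNReal.rpow_natCast]
      rw [pow_succ', ← mul_assoc, ENNReal.mul_inv_cancel (by simp) (by simp), one_mul,
        ENNReal.inv_pow]
    rw [e, ← mul_assoc, ← mul_assoc]
    gcongr
  -- Diameter zero has no matching scale, so let `d` tend to `0`.
  rcases eq_or_ne (ediam U) 0 with h | h
  · have h0 : Tendsto (fun d : ℝ => (3 ^ n * M * 2 ^ t) * ENNReal.ofReal d ^ t) (𝓝[>] 0)
        (𝓝 ((3 ^ n * M * 2 ^ t) * ENNReal.ofReal 0 ^ t)) := by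
      have hc : Continuous fun d : ℝ => ((3 : ℝ≥0∞) ^ n * M * 2 ^ t) * ENNReal.ofReal d ^ t := by
        refine ENNReal.continuous_const_mul ?_ |>.comp
          ((ENNReal.continuous_rpow_const).comp ENNReal.continuous_ofReal)
        exact ENNReal.mul_ne_top (by finiteness) (ENNReal.rpow_ne_top_of_nonneg ht.le (by simp))
      exact hc.continuousAt.continuousWithinAt
    rw [h, ← ENNReal.ofReal_zero]
    refine ge_of_tendsto h0 ?_
    filter_upwards [Ioc_mem_nhdsGT (zero_lt_one' ℝ)] with d hd
    exact key d hd.1 hd.2 (by simp [h])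
  · have hfin : ediam U ≠ ⊤ := ne_top_of_le_ne_top ENNReal.one_ne_top hU
    have := key (ediam U).toReal (ENNReal.toReal_pos h hfin)
      (by simpa using ENNReal.toReal_mono ENNReal.one_ne_top hU) (by rw [ENNReal.ofReal_toReal hfin])
    rwa [ENNReal.ofReal_toReal hfin] at this

/-- The energy is the integral of a potential, so the potential is finite almost everywhere. On a
sublevel set that meets `S` in positive measure, the mass distribution principle applies. -/
lemma le_dimH_of_dyadicEnergy_ne_top {n : ℕ} {t : ℝ} (ht : 0 < t) (ν : Measure (Eucl n))
    (hE : dyadicEnergy t ν ≠ ⊤) {S : Set (Eucl n)} (hS : ν S ≠ 0) :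
    ENNReal.ofReal t ≤ dimH S := by
  have hm : ∀ k : ℕ, Measurable fun x : Eucl n =>
      (2 : ℝ≥0∞) ^ (k * t) * ν (dyadicCube k (dyadicIndex k x)) := fun k =>
    ((measurable_of_countable fun z => ν (dyadicCube k z)).comp
      (measurable_dyadicIndex k)).const_mul _
  let G : ℕ → Set (Eucl n) := fun M =>
    {x | ∀ k : ℕ, (2 : ℝ≥0∞) ^ (k * t) * ν (dyadicCube k (dyadicIndex k x)) ≤ ((M + 1 : ℕ) : ℝ≥0)}
  have hGm : ∀ M, MeasurableSet (G M) := fun M => by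
    simp only [G, ofPred_forall]
    exact MeasurableSet.iInter fun k => measurableSet_le (hm k) measurable_const
  have hae : ∀ᵐ x ∂ν, x ∈ ⋃ M, G M := by
    have := ae_lt_top (Measurable.tsum hm)
      ((lintegral_dyadic_eq_energy t ν).symm ▸ hE)
    filter_upwards [this] with x hx
    obtain ⟨M, hM⟩ := ENNReal.exists_nat_gt hx.ne
    refine mem_iUnion.2 ⟨M, fun k => (ENNReal.le_tsum k).trans (hM.le.trans ?_)⟩
    simp
  obtain ⟨M, hM⟩ : ∃ M, ν (S ∩ G M) ≠ 0 := by
    by_contra! h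
    refine hS (le_antisymm ?_ zero_le)
    calc ν S ≤ ν (⋃ M, S ∩ G M) := by
          refine measure_mono_ae ?_
          filter_upwards [hae] with x hx hxS
          rw [← inter_iUnion]
          exact ⟨hxS, hx⟩
      _ ≤ 0 := by rw [measure_iUnion_null h]
  set c : ℝ≥0∞ := 3 ^ n * ((M + 1 : ℕ) : ℝ≥0) * 2 ^ t
  have hc0 : c ≠ 0 := by simp [c]
  have hct : c ≠ ⊤ :=
    ENNReal.mul_ne_top (by finiteness) (ENNReal.rpow_ne_top_of_nonneg ht.le (by simp))
  have hle : c⁻¹ • ν.restrict (G M) ≤ μH[t] := by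
    refine le_hausdorffMeasure t _ 1 one_pos fun U hU => ?_
    rw [Measure.smul_apply, smul_eq_mul, restrict_apply' (hGm M), ENNReal.inv_mul_le_iff hc0 hct]
    exact measure_inter_le_of_dyadic_bound ht ν (fun x hx => hx) hU
  have hH : μH[(t.toNNReal : ℝ)] S ≠ 0 := by
    rw [Real.coe_toNNReal _ ht.le]
    refine fun h => hM ?_
    have := (hle S).trans h.le
    rw [Measure.smul_apply, smul_eq_mul, restrict_apply' (hGm M)] at this
    simpa [hct] using this
  exact le_dimH_of_hausdorffMeasure_ne_zero hH

/-! ### Disintegration along the fibres of a projection. -/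

-- Disintegrating the image of `μ` under `x ↦ (p x, x)` and evaluating it on rectangles `E ×ˢ B`
-- gives the density.
open ProbabilityTheory in
lemma map_restrict_eq_withDensity_condKernel {n m : ℕ} (μ : Measure (Eucl n)) [IsFiniteMeasure μ]
    {p : Eucl n → Eucl m} (hp : Measurable p) (hac : μ.map p ≪ volume) {B : Set (Eucl n)}
    (hB : MeasurableSet B) :
    (μ.restrict B).map p = volume.withDensity
      (fun u => (μ.map p).rnDeriv volume u * (μ.map fun x => (p x, x)).condKernel u B) := by
  set ρ := μ.map fun x => (p x, x) with hρ
  have hfst : ρ.fst = μ.map p := fst_map_prodMk measurable_id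
  have hκ : Measurable fun u => ρ.condKernel u B := Kernel.measurable_coe _ hB
  change _ = volume.withDensity ((μ.map p).rnDeriv volume * fun u => ρ.condKernel u B)
  rw [withDensity_mul _ (measurable_rnDeriv _ _) hκ, withDensity_rnDeriv_eq _ _ hac]
  ext E hE
  rw [withDensity_apply _ hE, map_apply hp hE, restrict_apply (hp hE), ← hfst,
    ← compProd_apply_prod hE hB, ρ.disintegrate ρ.condKernel, hρ,
    map_apply (by fun_prop) (hE.prod hB)]
  rfl

open ProbabilityTheory in
lemma ae_le_dimH_fiber {n m : ℕ} {t : ℝ} (ht : 0 < t) (μ : Measure (Eucl n)) [IsFiniteMeasure μ]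
    {p : Eucl n → Eucl m} (hp : Measurable p) (hac : μ.map p ≪ volume) {F : Set (Eucl n)}
    (hF : ∀ᵐ x ∂μ, x ∈ F) (hFm : MeasurableSet F)
    (hE : ∑' k : ℕ, (2 : ℝ≥0∞) ^ (k * t) * ∑' z : Fin n → ℤ,
      ∫⁻ u, ((μ.restrict (dyadicCube k z)).map p).rnDeriv volume u ^ 2 ≠ ⊤) :
    ∀ᵐ u ∂(μ.map p), ENNReal.ofReal t ≤ dimH (p ⁻¹' {u} ∩ F) := by
  set ρ := μ.map fun x => (p x, x) with hρ
  set h := (μ.map p).rnDeriv volume with hh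
  have hfst : ρ.fst = μ.map p := fst_map_prodMk measurable_id
  have hhm : Measurable h := measurable_rnDeriv _ _
  have hκ : ∀ k z, Measurable fun u => ρ.condKernel u (dyadicCube k z) := fun k z =>
    Kernel.measurable_coe _ (measurableSet_dyadicCube k z)
  have hint : ∀ k z, ∫⁻ u, ((μ.restrict (dyadicCube k z)).map p).rnDeriv volume u ^ 2
      = ∫⁻ u, h u ^ 2 * ρ.condKernel u (dyadicCube k z) ^ 2 := by
    intro k z
    refine lintegral_congr_ae ?_
    rw [map_restrict_eq_withDensity_condKernel μ hp hac (measurableSet_dyadicCube k z)]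
    filter_upwards [rnDeriv_withDensity volume (hhm.mul (hκ k z))] with u hu
    rw [← mul_pow]
    exact congrArg (· ^ 2) hu
  have hsum : ∑' k : ℕ, (2 : ℝ≥0∞) ^ (k * t) * ∑' z : Fin n → ℤ,
      ∫⁻ u, ((μ.restrict (dyadicCube k z)).map p).rnDeriv volume u ^ 2
        = ∫⁻ u, h u ^ 2 * dyadicEnergy t (ρ.condKernel u) := by
    simp_rw [hint, dyadicEnergy, ← ENNReal.tsum_mul_left]
    rw [lintegral_tsum fun k => (Measurable.tsum fun z => by fun_prop).aemeasurable]
    refine tsum_congr fun k => ?_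
    rw [lintegral_tsum fun z => by fun_prop]
    refine tsum_congr fun z => ?_
    rw [← lintegral_const_mul _ (by fun_prop)]
    refine lintegral_congr fun u => ?_
    ring
  rw [hsum] at hE
  have hfin : ∀ᵐ u ∂(μ.map p), h u ^ 2 * dyadicEnergy t (ρ.condKernel u) < ⊤ := by
    refine hac.ae_le (ae_lt_top ?_ hE)
    unfold dyadicEnergy
    exact (hhm.pow_const 2).mul (Measurable.tsum fun k =>
      (Measurable.tsum fun z => (hκ k z).pow_const 2).const_mul _)
  have hmem : ∀ᵐ u ∂(μ.map p), ∀ᵐ x ∂(ρ.condKernel u), x ∈ p ⁻¹' {u} ∩ F := by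
    rw [← hfst]
    refine ae_ae_of_ae_compProd (p := fun y : Eucl m × Eucl n => y.2 ∈ p ⁻¹' {y.1} ∩ F) ?_
    rw [ρ.disintegrate ρ.condKernel, hρ, ae_map_iff (by fun_prop)]
    · filter_upwards [hF] with x hx
      exact ⟨rfl, hx⟩
    · exact (measurableSet_eq_fun (hp.comp measurable_snd) measurable_fst).inter
        (measurable_snd hFm)
  -- Positivity of `h` allows the finiteness of `h ^ 2 * dyadicEnergy` to pass to the energy itself.
  filter_upwards [hfin, hmem, rnDeriv_pos hac] with u h1 h2 h3
  refine le_dimH_of_dyadicEnergy_ne_top ht (ρ.condKernel u) ?_ ?_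
  · intro he
    rw [he, ENNReal.mul_top (pow_ne_zero 2 h3.ne')] at h1
    exact h1.ne rfl
  · intro h0
    have : ∀ᵐ x ∂(ρ.condKernel u), False := by
      filter_upwards [h2, measure_eq_zero_iff_ae_notMem.1 h0] with x hx hx'
      exact hx' hx
    rw [eventually_false_iff_eq_bot, ae_eq_bot] at this
    exact IsProbabilityMeasure.ne_zero _ this

/-! ### Rescaling the `L²` bound to balls of arbitrary radius. -/

lemma IsOrthProj.exists_continuousLinearMap {n m : ℕ} {p : Eucl n → Eucl m} (hp : IsOrthProj p) :
    ∃ L : Eucl n →L[ℝ] Eucl m, (∀ x, p x = L x) ∧ LipschitzWith 1 p := by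
  obtain ⟨V, e, he⟩ := hp
  refine ⟨(e : V →L[ℝ] Eucl m).comp V.orthogonalProjectionOnto, fun x => he x, ?_⟩
  rw [funext he]
  have h := e.lipschitz.comp V.lipschitzWith_orthogonalProjectionOnto
  rw [one_mul] at h
  exact h

lemma lintegral_comp_inv_smul_sub {m : ℕ} {r : ℝ} (hr : 0 < r) (a : Eucl m) {f : Eucl m → ℝ≥0∞}
    (hf : Measurable f) : ∫⁻ v, f (r⁻¹ • (v - a)) = ENNReal.ofReal (r ^ m) * ∫⁻ u, f u := by
  rw [lintegral_sub_right_eq_self (fun v => f (r⁻¹ • v)) a,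
    ← lintegral_map hf (measurable_const_smul r⁻¹), map_addHaar_smul volume (inv_ne_zero hr.ne'),
    lintegral_smul_measure, finrank_euclideanSpace_fin, inv_pow, inv_inv,
    abs_of_pos (pow_pos hr m), smul_eq_mul]

lemma map_eq_withDensity_of_rescaled {n m : ℕ} (ν : Measure (Eucl n)) [IsFiniteMeasure ν]
    (L : Eucl n →L[ℝ] Eucl m) {r : ℝ} (hr : 0 < r) (x₀ : Eucl n) {c : ℝ≥0∞} (hc : c ≠ 0)
    (hc' : c ≠ ⊤) (hac : (c • ν.map fun x => r⁻¹ • (x - x₀)).map L ≪ volume) :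
    ν.map L = volume.withDensity (fun v => c⁻¹ * (ENNReal.ofReal (r ^ m))⁻¹ *
      ((c • ν.map fun x => r⁻¹ • (x - x₀)).map L).rnDeriv volume (r⁻¹ • (v - L x₀))) := by
  set ν' := c • ν.map fun x => r⁻¹ • (x - x₀) with hν'
  have hfin : IsFiniteMeasure ν' := by
    rw [hν']; exact Measure.smul_finite _ hc'
  set g := (ν'.map L).rnDeriv volume with hg
  have hgm : Measurable g := measurable_rnDeriv _ _
  have hT : Measurable fun x : Eucl n => r⁻¹ • (x - x₀) := by fun_prop
  have hS : Measurable fun v : Eucl m => r⁻¹ • (v - L x₀) := by fun_prop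
  have hS' : Measurable fun v : Eucl m => r • v + L x₀ := by fun_prop
  have hκ : ENNReal.ofReal (r ^ m) ≠ 0 := by simpa using pow_pos hr m
  ext E hE
  have h1 : (ν'.map L) ((fun v => r • v + L x₀) ⁻¹' E) = c * (ν.map L) E := by
    rw [map_apply L.measurable (hS' hE), hν', Measure.smul_apply,
      map_apply hT (L.measurable (hS' hE)), map_apply L.measurable hE, smul_eq_mul]
    congr 2
    ext x
    simp [smul_smul, hr.ne']
  have h2 : (ν'.map L) ((fun v => r • v + L x₀) ⁻¹' E)
      = ∫⁻ u, ((fun v => r • v + L x₀) ⁻¹' E).indicator g u := by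
    rw [lintegral_indicator (hS' hE), ← withDensity_apply _ (hS' hE),
      withDensity_rnDeriv_eq _ _ hac]
  have h3 := lintegral_comp_inv_smul_sub hr (L x₀)
    (f := ((fun v => r • v + L x₀) ⁻¹' E).indicator g) (hgm.indicator (hS' hE))
  have h4 : ∀ v, ((fun v => r • v + L x₀) ⁻¹' E).indicator g (r⁻¹ • (v - L x₀))
      = E.indicator (fun v => g (r⁻¹ • (v - L x₀))) v := by
    intro v
    by_cases hv : v ∈ E <;> simp [indicator, smul_smul, hr.ne', hv]
  simp_rw [h4] at h3
  rw [lintegral_indicator hE, ← h2, h1] at h3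
  rw [withDensity_apply _ hE, lintegral_const_mul _ (by fun_prop), h3]
  rw [show c⁻¹ * (ENNReal.ofReal (r ^ m))⁻¹ * (ENNReal.ofReal (r ^ m) * (c * ν.map L E))
    = (c⁻¹ * c) * ((ENNReal.ofReal (r ^ m))⁻¹ * ENNReal.ofReal (r ^ m)) * ν.map L E by ring,
    ENNReal.inv_mul_cancel hc hc', ENNReal.inv_mul_cancel hκ ENNReal.ofReal_ne_top, one_mul, one_mul]

lemma lintegral_rnDeriv_sq_of_rescaled {n m : ℕ} (ν : Measure (Eucl n)) [IsFiniteMeasure ν]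
    (L : Eucl n →L[ℝ] Eucl m) {r : ℝ} (hr : 0 < r) (x₀ : Eucl n) {c : ℝ≥0∞} (hc : c ≠ 0)
    (hc' : c ≠ ⊤) (hac : (c • ν.map fun x => r⁻¹ • (x - x₀)).map L ≪ volume) :
    ∫⁻ u, (ν.map L).rnDeriv volume u ^ 2 = (c⁻¹ ^ 2 * (ENNReal.ofReal (r ^ m))⁻¹) *
      ∫⁻ u, ((c • ν.map fun x => r⁻¹ • (x - x₀)).map L).rnDeriv volume u ^ 2 := by
  have h := map_eq_withDensity_of_rescaled ν L hr x₀ hc hc' hac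
  set g := ((c • ν.map fun x => r⁻¹ • (x - x₀)).map L).rnDeriv volume with hg
  have hgm : Measurable g := measurable_rnDeriv _ _
  have hκ : ENNReal.ofReal (r ^ m) ≠ 0 := by simpa using pow_pos hr m
  rw [h]
  have h2 : ∫⁻ u, (volume.withDensity fun v => c⁻¹ * (ENNReal.ofReal (r ^ m))⁻¹ *
      g (r⁻¹ • (v - L x₀))).rnDeriv volume u ^ 2
      = ∫⁻ v, (c⁻¹ * (ENNReal.ofReal (r ^ m))⁻¹) ^ 2 * (fun u => g u ^ 2) (r⁻¹ • (v - L x₀)) := by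
    refine lintegral_congr_ae ?_
    filter_upwards [rnDeriv_withDensity volume (f := fun v => c⁻¹ * (ENNReal.ofReal (r ^ m))⁻¹ *
      g (r⁻¹ • (v - L x₀))) (by fun_prop)] with v hv
    rw [hv, mul_pow]
  rw [h2, lintegral_const_mul _ (by fun_prop),
    lintegral_comp_inv_smul_sub hr (L x₀) (f := fun u => g u ^ 2) (by fun_prop), ← mul_assoc]
  congr 1
  rw [mul_pow, sq (ENNReal.ofReal (r ^ m))⁻¹, mul_assoc, mul_assoc,
    ENNReal.inv_mul_cancel hκ ENNReal.ofReal_ne_top, mul_one]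

/-- `rnDeriv` is chosen separately for each `l`, so joint measurability is not available directly.
By Besicovitch differentiation it agrees almost everywhere with a limsup of ball ratios, which is
jointly measurable. -/
lemma measurable_lintegral_rnDeriv_sq {n m : ℕ} {Λ : Type*} [MeasurableSpace Λ]
    (P : Λ → Eucl n → Eucl m) (hP : Measurable fun q : Λ × Eucl n => P q.1 q.2)
    (ν : Measure (Eucl n)) [IsFiniteMeasure ν] :
    Measurable fun l => ∫⁻ u, (ν.map (P l)).rnDeriv volume u ^ 2 := by
  let R : ℕ → ℝ := fun k => 1 / ((k : ℝ) + 1)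
  let g : Λ → Eucl m → ℝ≥0∞ := fun l u =>
    limsup (fun k => ν {x | dist (P l x) u ≤ R k} / volume (closedBall (0 : Eucl m) (R k))) atTop
  have hPl : ∀ l, Measurable (P l) := fun l => hP.comp measurable_prodMk_left
  have hg : Measurable (Function.uncurry g) := by
    refine Measurable.limsup fun k => Measurable.div_const ?_ _
    have hm : MeasurableSet {q : (Λ × Eucl m) × Eucl n | dist (P q.1.1 q.2) q.1.2 ≤ R k} := by
      refine measurableSet_le (Measurable.dist ?_ ?_) measurable_const
      · exact hP.comp ((measurable_fst.comp measurable_fst).prodMk measurable_snd)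
      · exact measurable_snd.comp measurable_fst
    exact measurable_measure_prodMk_left hm
  have heq : ∀ l, ∫⁻ u, (ν.map (P l)).rnDeriv volume u ^ 2 = ∫⁻ u, g l u ^ 2 := by
    intro l
    refine lintegral_congr_ae ?_
    filter_upwards [Besicovitch.ae_tendsto_rnDeriv (ν.map (P l)) volume] with u hu
    have hR : Tendsto R atTop (𝓝[>] 0) :=
      tendsto_nhdsWithin_iff.2 ⟨tendsto_one_div_add_atTop_nhds_zero_nat,
        Eventually.of_forall fun k => by simp only [R, mem_Ioi]; positivity⟩
    have := (hu.comp hR).limsup_eq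
    rw [← this]
    congr 2
    ext k
    simp only [Function.comp]
    rw [map_apply (hPl l) measurableSet_closedBall, addHaar_closedBall_center volume u]
    rfl
  simp_rw [heq]
  exact Measurable.lintegral_prod_right' (f := fun q : Λ × Eucl m => g q.1 q.2 ^ 2)
    (hg.pow_const 2)

/-- Blowing the ball up to unit size and dividing by `r ^ s` preserves the Frostman condition.
Undoing this multiplies the squared `L²` norm by `r ^ (2 * s - m)` and the mass by `r ^ (-s)`, which
leaves `r ^ (s - m)`. -/
lemma lintegral_rnDeriv_sq_le_of_closedBall {n m : ℕ} {s : ℝ} {Λ : Type*} [MeasurableSpace Λ]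
    {ω : Measure Λ} {P : Λ → Eucl n → Eucl m} (hP : ∀ l, IsOrthProj (P l)) {C : ℝ}
    (hC : ∀ μ : Measure (Eucl n), MemM (closedBall 0 1) μ → IsFrostman s μ →
      (∀ᵐ l ∂ω, μ.map (P l) ≪ volume) ∧
        ∫⁻ l, (∫⁻ u, ((μ.map (P l)).rnDeriv volume u) ^ 2 ∂volume) ∂ω
          < ENNReal.ofReal C * μ (closedBall 0 1))
    (ν : Measure (Eucl n)) [IsFiniteMeasure ν] (hν : IsFrostman s ν) {x₀ : Eucl n} {r : ℝ}
    (hr : 0 < r) (hball : ν (closedBall x₀ r)ᶜ = 0) :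
    (∀ᵐ l ∂ω, ν.map (P l) ≪ volume) ∧
      ∫⁻ l, (∫⁻ u, (ν.map (P l)).rnDeriv volume u ^ 2) ∂ω
        ≤ ENNReal.ofReal C * ENNReal.ofReal (r ^ (s - m)) * ν univ := by
  -- `MemM` excludes the zero measure.
  rcases eq_or_ne ν 0 with rfl | hν0
  · have h0 : ∀ l, ∫⁻ u, ((0 : Measure (Eucl n)).map (P l)).rnDeriv volume u ^ 2 = 0 := by
      intro l
      rw [Measure.map_zero, lintegral_eq_zero_iff (by fun_prop)]
      filter_upwards [rnDeriv_zero (volume : Measure (Eucl m))] with u hu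
      simp [hu]
    refine ⟨ae_of_all _ fun l => ?_, ?_⟩
    · rw [Measure.map_zero]; exact AbsolutelyContinuous.zero _
    · simp only [h0, lintegral_zero, zero_le]
  set c := ENNReal.ofReal (r ^ (-s)) with hcdef
  have hrs : 0 < r ^ (-s) := Real.rpow_pos_of_pos hr _
  have hc : c ≠ 0 := by simpa [c] using hrs
  have hc' : c ≠ ⊤ := ENNReal.ofReal_ne_top
  set ν' := c • ν.map fun x => r⁻¹ • (x - x₀) with hν'
  have hT : Measurable fun x : Eucl n => r⁻¹ • (x - x₀) := by fun_prop
  have hpre : ∀ (y : Eucl n) (ρ : ℝ), (fun x : Eucl n => r⁻¹ • (x - x₀)) ⁻¹' closedBall y ρ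
      = closedBall (x₀ + r • y) (r * ρ) := by
    intro y ρ
    ext x
    have e : r⁻¹ • (x - x₀) - y = r⁻¹ • (x - (x₀ + r • y)) := by
      rw [← sub_sub, smul_sub r⁻¹ (x - x₀), smul_smul, inv_mul_cancel₀ hr.ne', one_smul]
    rw [mem_preimage, mem_closedBall, mem_closedBall, dist_eq_norm, dist_eq_norm, e, norm_smul,
      Real.norm_of_nonneg (inv_nonneg.2 hr.le), inv_mul_le_iff₀ hr]
  have happ : ∀ (y : Eucl n) (ρ : ℝ),
      ν' (closedBall y ρ) = c * ν (closedBall (x₀ + r • y) (r * ρ)) := by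
    intro y ρ
    rw [hν', Measure.smul_apply, smul_eq_mul, map_apply hT measurableSet_closedBall, hpre]
  have hball' : ν (closedBall x₀ r) = ν univ := by
    rw [← measure_add_measure_compl (μ := ν) (measurableSet_closedBall (x := x₀) (ε := r)), hball,
      add_zero]
  have hB1 : ν' (closedBall 0 1) = c * ν univ := by
    rw [happ, smul_zero, add_zero, mul_one, hball']
  have hsupp : ν'.support ⊆ closedBall 0 1 := by
    refine support_subset_of_isClosed isClosed_closedBall ?_
    rw [mem_ae_iff, hν', Measure.smul_apply, map_apply hT measurableSet_closedBall.compl,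
      preimage_compl, hpre]
    simp [hball]
  have hMem : MemM (closedBall 0 1) ν' := by
    refine ⟨?_, ?_, (isCompact_closedBall 0 1).of_isClosed_subset isClosed_support hsupp, hsupp⟩
    · rw [hB1]
      exact ENNReal.mul_pos hc (measure_univ_ne_zero.2 hν0)
    · rw [hB1]
      exact ENNReal.mul_lt_top hc'.lt_top (measure_lt_top ν _)
  have hFr : IsFrostman s ν' := by
    intro y ρ hρ
    rw [happ]
    refine (mul_le_mul_right (hν _ _ (mul_pos hr hρ)) c).trans ?_
    rw [hcdef, ← ENNReal.ofReal_mul hrs.le, Real.mul_rpow hr.le hρ.le, ← mul_assoc,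
      ← Real.rpow_add hr, neg_add_cancel, Real.rpow_zero, one_mul]
  obtain ⟨hac, hint⟩ := hC ν' hMem hFr
  have hl : ∀ᵐ l ∂ω, ν.map (P l) ≪ volume ∧ ∫⁻ u, (ν.map (P l)).rnDeriv volume u ^ 2 =
      (c⁻¹ ^ 2 * (ENNReal.ofReal (r ^ m))⁻¹) *
        ∫⁻ u, (ν'.map (P l)).rnDeriv volume u ^ 2 := by
    filter_upwards [hac] with l hl
    obtain ⟨L, hL, -⟩ := (hP l).exists_continuousLinearMap
    have hPL : P l = L := funext hL
    rw [hPL] at hl ⊢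
    refine ⟨?_, lintegral_rnDeriv_sq_of_rescaled ν L hr x₀ hc hc' hl⟩
    rw [map_eq_withDensity_of_rescaled ν L hr x₀ hc hc' hl]
    exact withDensity_absolutelyContinuous _ _
  refine ⟨hl.mono fun l h => h.1, ?_⟩
  have hκ : 0 < r ^ m := pow_pos hr m
  have hκ' : ENNReal.ofReal (r ^ m) ≠ 0 := by simpa using hκ
  rw [lintegral_congr_ae (hl.mono fun l h => h.2), lintegral_const_mul' _ _
    (ENNReal.mul_ne_top (ENNReal.pow_ne_top (ENNReal.inv_ne_top.2 hc)) (ENNReal.inv_ne_top.2 hκ'))]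
  refine (mul_le_mul_right hint.le _).trans (le_of_eq ?_)
  have e : ENNReal.ofReal (r ^ (s - m)) = c⁻¹ * (ENNReal.ofReal (r ^ m))⁻¹ := by
    rw [hcdef, ← ENNReal.ofReal_inv_of_pos hrs, ← ENNReal.ofReal_inv_of_pos hκ,
      ← ENNReal.ofReal_mul (by positivity), Real.rpow_neg hr.le, inv_inv, Real.rpow_sub hr,
      Real.rpow_natCast, div_eq_mul_inv]
  rw [hB1, e]
  calc c⁻¹ ^ 2 * (ENNReal.ofReal (r ^ m))⁻¹ * (ENNReal.ofReal C * (c * ν univ))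
      = ENNReal.ofReal C * (c⁻¹ * (ENNReal.ofReal (r ^ m))⁻¹) * ν univ * (c⁻¹ * c) := by ring
    _ = _ := by rw [ENNReal.inv_mul_cancel hc hc', mul_one]

/-! ### Summing the rescaled bound over dyadic cubes. -/

lemma two_rpow_mul_ofReal_rpow_half (a : ℝ) (ha : 0 < a) (t β : ℝ) (k : ℕ) :
    (2 : ℝ≥0∞) ^ (k * t) * ENNReal.ofReal ((a * (1 / 2) ^ k) ^ β)
      = ENNReal.ofReal (a ^ β) * ENNReal.ofReal (2 ^ (t - β)) ^ k := by
  rw [← ENNReal.ofReal_ofNat 2, ENNReal.ofReal_rpow_of_pos two_pos,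
    ← ENNReal.ofReal_pow (by positivity), ← ENNReal.ofReal_mul (by positivity),
    ← ENNReal.ofReal_mul (by positivity)]
  congr 1
  rw [Real.mul_rpow ha.le (by positivity), ← Real.rpow_natCast (2 ^ (t - β)) k,
    ← Real.rpow_mul two_pos.le, one_div, inv_pow, ← Real.rpow_natCast 2 k,
    ← Real.rpow_neg two_pos.le, ← Real.rpow_mul two_pos.le, mul_left_comm,
    ← Real.rpow_add two_pos]
  congr 2
  ring

lemma ae_absolutelyContinuous_and_energy {n m : ℕ} {s t : ℝ} {Λ : Type*} [MeasurableSpace Λ]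
    {ω : Measure Λ} {P : Λ → Eucl n → Eucl m} (hP : ∀ l, IsOrthProj (P l))
    (hPm : Measurable fun q : Λ × Eucl n => P q.1 q.2) {C : ℝ}
    (hC : ∀ μ : Measure (Eucl n), MemM (closedBall 0 1) μ → IsFrostman s μ →
      (∀ᵐ l ∂ω, μ.map (P l) ≪ volume) ∧
        ∫⁻ l, (∫⁻ u, ((μ.map (P l)).rnDeriv volume u) ^ 2 ∂volume) ∂ω
          < ENNReal.ofReal C * μ (closedBall 0 1))
    (μ : Measure (Eucl n)) [IsFiniteMeasure μ] (hμ : IsFrostman s μ) (hts : t < s - m) :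
    ∀ᵐ l ∂ω, μ.map (P l) ≪ volume ∧
      ∑' k : ℕ, (2 : ℝ≥0∞) ^ (k * t) * ∑' z : Fin n → ℤ,
        ∫⁻ u, ((μ.restrict (dyadicCube k z)).map (P l)).rnDeriv volume u ^ 2 ≠ ⊤ := by
  have hPl : ∀ l, Measurable (P l) := fun l => hPm.comp measurable_prodMk_left
  have hcube : ∀ (k : ℕ) (z : Fin n → ℤ),
      (∀ᵐ l ∂ω, (μ.restrict (dyadicCube k z)).map (P l) ≪ volume) ∧
        ∫⁻ l, (∫⁻ u, ((μ.restrict (dyadicCube k z)).map (P l)).rnDeriv volume u ^ 2) ∂ω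
          ≤ ENNReal.ofReal C * ENNReal.ofReal (((n + 1) * (1 / 2) ^ k) ^ (s - m)) *
            μ (dyadicCube k z) := by
    intro k z
    obtain ⟨x₀, hx₀⟩ : ∃ x₀ : Eucl n, dyadicCube k z ⊆ closedBall x₀ ((n + 1) * (1 / 2) ^ k) := by
      rcases (dyadicCube (n := n) k z).eq_empty_or_nonempty with h | ⟨x, hx⟩
      · exact ⟨0, h ▸ empty_subset _⟩
      · exact ⟨x, dyadicCube_subset_closedBall hx⟩
    have h := lintegral_rnDeriv_sq_le_of_closedBall hP hC (μ.restrict (dyadicCube k z))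
      (fun x r hr => (restrict_apply_le _ _).trans (hμ x r hr)) (x₀ := x₀)
      (r := (n + 1) * (1 / 2) ^ k) (by positivity) (by
        rw [Measure.restrict_apply measurableSet_closedBall.compl,
          (disjoint_compl_left_iff_subset.2 hx₀).inter_eq, measure_empty])
    rwa [restrict_apply_univ] at h
  have hmeas : ∀ k z, Measurable fun l =>
      ∫⁻ u, ((μ.restrict (dyadicCube k z)).map (P l)).rnDeriv volume u ^ 2 := fun k z =>
    measurable_lintegral_rnDeriv_sq P hPm _
  have hmeas' : ∀ k : ℕ, Measurable fun l => (2 : ℝ≥0∞) ^ (k * t) * ∑' z : Fin n → ℤ,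
      ∫⁻ u, ((μ.restrict (dyadicCube k z)).map (P l)).rnDeriv volume u ^ 2 := fun k =>
    (Measurable.tsum (hmeas k)).const_mul _
  have htot : ∫⁻ l, (∑' k : ℕ, (2 : ℝ≥0∞) ^ (k * t) * ∑' z : Fin n → ℤ,
      ∫⁻ u, ((μ.restrict (dyadicCube k z)).map (P l)).rnDeriv volume u ^ 2) ∂ω ≠ ⊤ := by
    have hle : ∀ k : ℕ, ∫⁻ l, ((2 : ℝ≥0∞) ^ (k * t) * ∑' z : Fin n → ℤ,
        ∫⁻ u, ((μ.restrict (dyadicCube k z)).map (P l)).rnDeriv volume u ^ 2) ∂ω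
          ≤ (ENNReal.ofReal C * ENNReal.ofReal ((n + 1 : ℝ) ^ (s - m)) * μ univ) *
            ENNReal.ofReal (2 ^ (t - (s - m))) ^ k := by
      intro k
      rw [lintegral_const_mul _ (Measurable.tsum (hmeas k)),
        lintegral_tsum fun z => (hmeas k z).aemeasurable]
      calc (2 : ℝ≥0∞) ^ (k * t) * ∑' z : Fin n → ℤ,
          ∫⁻ l, (∫⁻ u, ((μ.restrict (dyadicCube k z)).map (P l)).rnDeriv volume u ^ 2) ∂ω
          ≤ (2 : ℝ≥0∞) ^ (k * t) * ∑' z : Fin n → ℤ, ENNReal.ofReal C *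
            ENNReal.ofReal (((n + 1) * (1 / 2) ^ k) ^ (s - m)) * μ (dyadicCube k z) := by
            gcongr with z
            exact (hcube k z).2
        _ = ENNReal.ofReal C * μ univ * ((2 : ℝ≥0∞) ^ (k * t) *
            ENNReal.ofReal (((n + 1) * (1 / 2) ^ k) ^ (s - m))) := by
            rw [ENNReal.tsum_mul_left, ← measure_iUnion (pairwise_disjoint_dyadicCube k)
              (measurableSet_dyadicCube k), iUnion_dyadicCube]
            ring
        _ = _ := by
            rw [two_rpow_mul_ofReal_rpow_half _ (by positivity)]
            ring
    rw [lintegral_tsum fun k => (hmeas' k).aemeasurable]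
    refine ne_top_of_le_ne_top ?_ (ENNReal.tsum_le_tsum hle)
    rw [ENNReal.tsum_mul_left, ENNReal.tsum_geometric]
    refine ENNReal.mul_ne_top (by finiteness) (ENNReal.inv_ne_top.2 (tsub_pos_iff_lt.2 ?_).ne')
    rw [← ENNReal.ofReal_one, ENNReal.ofReal_lt_ofReal_iff one_pos]
    exact Real.rpow_lt_one_of_one_lt_of_neg one_lt_two (by linarith)
  -- `μ` may have unbounded support, so its absolute continuity is assembled from the countably many
  -- unit cubes.
  filter_upwards [ae_all_iff.2 fun z => (hcube 0 z).1, ae_lt_top (Measurable.tsum hmeas') htot]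
    with l h1 h2
  refine ⟨AbsolutelyContinuous.mk fun E hE hE0 => ?_, h2.ne⟩
  rw [map_apply (hPl l) hE]
  have hu : P l ⁻¹' E = ⋃ z : Fin n → ℤ, P l ⁻¹' E ∩ dyadicCube 0 z := by
    rw [← inter_iUnion, iUnion_dyadicCube, inter_univ]
  rw [hu]
  refine measure_iUnion_null fun z => ?_
  have := h1 z hE0
  rwa [map_apply (hPl l) hE, restrict_apply (hPl l hE)] at this

/-! ### A Frostman measure on a Borel subset of `A`. -/

/-- The upper density bound: balls of too large density cover only an `μH[s]`-null set. -/
lemma hausdorffMeasure_setOf_dense_balls {n : ℕ} {s : ℝ} (hs : 0 < s) (μ : Measure (Eucl n))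
    [IsFiniteMeasure μ] :
    (μH[s] : Measure (Eucl n))
      {x | ∀ N : ℕ, ∃ r : ℝ, 0 < r ∧ ENNReal.ofReal (N * r ^ s) < μ (closedBall x r)} = 0 := by
  set E := {x : Eucl n | ∀ N : ℕ, ∃ r : ℝ, 0 < r ∧ ENNReal.ofReal (N * r ^ s) < μ (closedBall x r)}
  set K : ℝ := μ.real univ
  -- The largest radius possible for a ball with `(N + 1) * r ^ s ≤ μ (closedBall x r)`.
  let R : ℕ → ℝ := fun N => (K / (N + 1)) ^ s⁻¹
  have hR0 : Tendsto R atTop (𝓝 0) := by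
    have h1 : Tendsto (fun N : ℕ => K / ((N : ℝ) + 1)) atTop (𝓝 0) := by
      simpa [div_eq_mul_inv] using tendsto_one_div_add_atTop_nhds_zero_nat.const_mul K
    have := h1.rpow_const (p := s⁻¹) (Or.inr (inv_nonneg.2 hs.le))
    rwa [Real.zero_rpow (inv_pos.2 hs).ne'] at this
  have hcov : ∀ N : ℕ, ∃ (u : Set (Eucl n × ℝ)), u.Countable ∧
      E ⊆ ⋃ b : u, closedBall b.1.1 (4 * b.1.2) ∧
      (∀ b ∈ u, 0 < b.2 ∧ b.2 ≤ R N) ∧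
      ∑' b : u, ediam (closedBall b.1.1 (4 * b.1.2)) ^ s ≤ ENNReal.ofReal (8 ^ s * K / (N + 1)) := by
    intro N
    let T : Set (Eucl n × ℝ) :=
      {q | 0 < q.2 ∧ ENNReal.ofReal ((N + 1 : ℕ) * q.2 ^ s) < μ (closedBall q.1 q.2)}
    have hTlt : ∀ q ∈ T, ((N : ℝ) + 1) * q.2 ^ s ≤ μ.real (closedBall q.1 q.2) := by
      intro q hq
      have := (ENNReal.ofReal_le_iff_le_toReal (measure_ne_top _ _)).1 hq.2.le
      push_cast at this
      exact this
    have hTR : ∀ q ∈ T, q.2 ≤ R N := by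
      intro q hq
      have h1 : ((N : ℝ) + 1) * q.2 ^ s ≤ K := (hTlt q hq).trans (measureReal_mono (subset_univ _))
      have h2 : q.2 ^ s ≤ K / (N + 1) := by rwa [le_div_iff₀' (by positivity)]
      calc q.2 = (q.2 ^ s) ^ s⁻¹ := by rw [Real.rpow_rpow_inv hq.1.le hs.ne']
        _ ≤ R N := Real.rpow_le_rpow (Real.rpow_nonneg hq.1.le _) h2 (inv_nonneg.2 hs.le)
    -- Any enlargement factor above `3` serves. Disjointness bounds the sum of `r ^ s` by `K / (N +
    -- 1)`, which tends to `0`.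
    obtain ⟨u, huT, hdis, hu⟩ := Vitali.exists_disjoint_subfamily_covering_enlargement_closedBall
      T (fun q => q.1) (fun q => q.2) (R N) hTR 4 (by norm_num)
    have hcount : u.Countable := hdis.countable_of_nonempty_interior fun q hq =>
      ⟨q.1, ball_subset_interior_closedBall (mem_ball_self (huT hq).1)⟩
    refine ⟨u, hcount, ?_, fun b hb => ⟨(huT hb).1, hTR b (huT hb)⟩, ?_⟩
    · intro x hx
      obtain ⟨r, hr, hxr⟩ := hx (N + 1)
      obtain ⟨b, hb, hsub⟩ := hu (x, r) ⟨hr, hxr⟩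
      exact mem_iUnion.2 ⟨⟨b, hb⟩, hsub (mem_closedBall_self hr.le)⟩
    · have hterm : ∀ b : u, ediam (closedBall b.1.1 (4 * b.1.2)) ^ s ≤
          ENNReal.ofReal (8 ^ s / (N + 1)) * μ (closedBall b.1.1 b.1.2) := by
        intro b
        have hb := huT b.2
        have hb0 : 0 < b.1.2 := hb.1
        calc ediam (closedBall b.1.1 (4 * b.1.2)) ^ s ≤ ENNReal.ofReal (8 * b.1.2) ^ s := by
              gcongr
              rw [← closedEBall_ofReal (by positivity)]
              refine ediam_closedEBall_le.trans (le_of_eq ?_)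
              rw [← ENNReal.ofReal_ofNat 2, ← ENNReal.ofReal_mul (by norm_num)]
              congr 1; ring
          _ = ENNReal.ofReal (8 ^ s / (N + 1)) * ENNReal.ofReal ((N + 1 : ℕ) * b.1.2 ^ s) := by
              rw [ENNReal.ofReal_rpow_of_pos (by positivity), ← ENNReal.ofReal_mul (by positivity),
                Real.mul_rpow (by norm_num) hb0.le]
              congr 1
              push_cast
              field_simp
          _ ≤ _ := by gcongr; exact hb.2.le
      have : Countable u := hcount.to_subtype
      calc ∑' b : u, ediam (closedBall b.1.1 (4 * b.1.2)) ^ s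
          ≤ ∑' b : u, ENNReal.ofReal (8 ^ s / (N + 1)) * μ (closedBall b.1.1 b.1.2) :=
            ENNReal.tsum_le_tsum hterm
        _ = ENNReal.ofReal (8 ^ s / (N + 1)) * μ (⋃ b : u, closedBall b.1.1 b.1.2) := by
            rw [ENNReal.tsum_mul_left, measure_iUnion _ fun _ => measurableSet_closedBall]
            intro b b' hbb'
            exact hdis b.2 b'.2 fun h => hbb' (Subtype.ext h)
        _ ≤ ENNReal.ofReal (8 ^ s / (N + 1)) * μ univ := by gcongr; exact subset_univ _
        _ = _ := by
            rw [← ofReal_measureReal (measure_ne_top μ univ), ← ENNReal.ofReal_mul (by positivity)]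
            congr 1; ring
  choose u hcount hcov hu hsum using hcov
  have hc : ∀ N, Countable (u N) := fun N => (hcount N).to_subtype
  have hr : Tendsto (fun N => 2 * ENNReal.ofReal (4 * R N)) atTop (𝓝 0) := by
    have h1 := ENNReal.tendsto_ofReal (hR0.const_mul 4)
    rw [mul_zero, ENNReal.ofReal_zero] at h1
    simpa using ENNReal.Tendsto.const_mul h1 (Or.inr ENNReal.ofNat_ne_top)
  have hle := hausdorffMeasure_le_liminf_tsum s E (fun N => 2 * ENNReal.ofReal (4 * R N)) hr
    (fun N (b : u N) => closedBall b.1.1 (4 * b.1.2))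
    (Eventually.of_forall fun N b => by
      have hb := hu N b.1 b.2
      rw [← closedEBall_ofReal (by linarith)]
      refine ediam_closedEBall_le.trans ?_
      gcongr
      exact hb.2)
    (Eventually.of_forall hcov)
  have hlim : Tendsto (fun N : ℕ => ENNReal.ofReal (8 ^ s * K / (N + 1))) atTop (𝓝 0) := by
    rw [← ENNReal.ofReal_zero]
    refine ENNReal.tendsto_ofReal ?_
    simpa [div_eq_mul_inv] using tendsto_one_div_add_atTop_nhds_zero_nat.const_mul (8 ^ s * K)
  exact le_antisymm (hle.trans ((liminf_le_liminf (Eventually.of_forall hsum)).trans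
    hlim.liminf_eq.le)) zero_le

/-- Testing the Carathéodory condition on a measurable hull of `A` shows that the excess is null; a
measurable hull of the excess is then removed. -/
lemma exists_measurableSet_subset_of_isCaratheodory {X : Type*} [MeasurableSpace X] (μ : Measure X)
    {A : Set X} (hA : μ.toOuterMeasure.IsCaratheodory A) (hfin : μ A ≠ ⊤) :
    ∃ F ⊆ A, MeasurableSet F ∧ μ F = μ A := by
  have h := hA (toMeasurable μ A)
  have h' : μ (toMeasurable μ A) = μ (toMeasurable μ A ∩ A) + μ (toMeasurable μ A \ A) := h
  rw [inter_eq_self_of_subset_right (subset_toMeasurable μ A), measure_toMeasurable] at h'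
  have h0 : μ (toMeasurable μ A \ A) = 0 := by
    refine (ENNReal.add_right_inj hfin).1 ?_
    rw [add_zero, ← h']
  refine ⟨toMeasurable μ A \ toMeasurable μ (toMeasurable μ A \ A), ?_,
    (measurableSet_toMeasurable _ _).diff (measurableSet_toMeasurable _ _), ?_⟩
  · rintro x ⟨hx, hx'⟩
    by_contra hxA
    exact hx' (subset_toMeasurable _ _ ⟨hx, hxA⟩)
  · rw [measure_sdiff_null (by rw [measure_toMeasurable, h0]), measure_toMeasurable]

lemma isClosed_setOf_frostman_at {n : ℕ} {s : ℝ} (μ : Measure (Eucl n))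
    (N : ℕ) : IsClosed {x | ∀ r : ℝ, 0 < r → μ (closedBall x r) ≤ ENNReal.ofReal (N * r ^ s)} := by
  refine isClosed_of_closure_subset fun x hx r hr => ?_
  have hlim : Tendsto (fun ε : ℝ => ENNReal.ofReal (N * (r + ε) ^ s)) (𝓝[>] 0)
      (𝓝 (ENNReal.ofReal (N * r ^ s))) := by
    have h1 : ContinuousAt (fun ε : ℝ => ENNReal.ofReal (N * (r + ε) ^ s)) 0 := by
      refine ENNReal.continuous_ofReal.continuousAt.comp (ContinuousAt.mul continuousAt_const ?_)
      exact ContinuousAt.rpow_const (by fun_prop) (Or.inl (by simpa using hr.ne'))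
    have h2 := h1.tendsto
    rw [add_zero] at h2
    exact h2.mono_left nhdsWithin_le_nhds
  refine ge_of_tendsto hlim ?_
  filter_upwards [self_mem_nhdsWithin] with ε hε
  obtain ⟨y, hy, hxy⟩ := Metric.mem_closure_iff.1 hx ε hε
  refine (measure_mono (closedBall_subset_closedBall' ?_)).trans (hy (r + ε) (add_pos hr hε))
  linarith

/-- A set of positive finite Hausdorff measure carries a nonzero Frostman measure that is
concentrated on a Borel subset. -/
lemma exists_isFrostman_of_isCaratheodory {n : ℕ} {s : ℝ} (hs : 0 < s) {A : Set (Eucl n)}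
    (hA : (μH[s] : Measure (Eucl n)).toOuterMeasure.IsCaratheodory A)
    (hA0 : 0 < (μH[s] : Measure (Eucl n)) A) (hAfin : (μH[s] : Measure (Eucl n)) A < ⊤) :
    ∃ (F : Set (Eucl n)) (μ : Measure (Eucl n)), F ⊆ A ∧ MeasurableSet F ∧ IsFiniteMeasure μ ∧
      μ ≠ 0 ∧ (∀ᵐ x ∂μ, x ∈ F) ∧ IsFrostman s μ := by
  obtain ⟨B, hBA, hBm, hB⟩ := exists_measurableSet_subset_of_isCaratheodory _ hA hAfin.ne
  set σ := (μH[s] : Measure (Eucl n)).restrict B with hσ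
  have hfin : IsFiniteMeasure σ := ⟨by rw [hσ, restrict_apply_univ, hB]; exact hAfin⟩
  let G : ℕ → Set (Eucl n) := fun N =>
    {x | ∀ r : ℝ, 0 < r → σ (closedBall x r) ≤ ENNReal.ofReal (N * r ^ s)}
  have hGm : ∀ N, MeasurableSet (G N) := fun N => (isClosed_setOf_frostman_at σ N).measurableSet
  obtain ⟨N, hN⟩ : ∃ N, (μH[s] : Measure (Eucl n)) (B ∩ G N) ≠ 0 := by
    by_contra! h
    have hcov : B ⊆ (⋃ N, B ∩ G N) ∪
        {x | ∀ N : ℕ, ∃ r : ℝ, 0 < r ∧ ENNReal.ofReal (N * r ^ s) < σ (closedBall x r)} := by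
      intro x hx
      by_cases hx' : ∃ N, x ∈ G N
      · obtain ⟨N, hN⟩ := hx'
        exact Or.inl (mem_iUnion.2 ⟨N, hx, hN⟩)
      · refine Or.inr fun N => ?_
        by_contra! h'
        exact hx' ⟨N, h'⟩
    have := measure_mono_null hcov
      (measure_union_null (measure_iUnion_null h) (hausdorffMeasure_setOf_dense_balls hs σ))
    exact hA0.ne' (hB ▸ this)
  -- A ball meeting `G N` at `y` lies in the ball of twice the radius about `y`, hence `2 ^ s`; `N +
  -- 1` avoids dividing by zero.
  set c : ℝ := ((N + 1 : ℝ) * 2 ^ s)⁻¹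
  have hc : 0 < c := by positivity
  refine ⟨B ∩ G N, ENNReal.ofReal c • σ.restrict (G N), inter_subset_left.trans hBA,
    hBm.inter (hGm N), Measure.smul_finite _ ENNReal.ofReal_ne_top, ?_, ?_, ?_⟩
  · intro h0
    have h1 : (ENNReal.ofReal c • σ.restrict (G N)) univ = 0 := by simp [h0]
    rw [Measure.smul_apply, restrict_apply_univ, hσ, restrict_apply (hGm N), inter_comm, smul_eq_mul,
      mul_eq_zero] at h1
    exact h1.elim (by simpa using hc) hN
  · refine ae_smul_measure ?_ _
    rw [hσ, restrict_restrict (hGm N), inter_comm (G N)]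
    exact ae_restrict_mem (hBm.inter (hGm N))
  · intro x r hr
    rw [Measure.smul_apply, smul_eq_mul, Measure.restrict_apply measurableSet_closedBall]
    rcases (closedBall x r ∩ G N).eq_empty_or_nonempty with h | ⟨y, hyx, hy⟩
    · simp [h]
    calc ENNReal.ofReal c * σ (closedBall x r ∩ G N)
        ≤ ENNReal.ofReal c * ENNReal.ofReal (N * (2 * r) ^ s) := by
          gcongr
          refine (measure_mono (inter_subset_left.trans (closedBall_subset_closedBall' ?_))).trans
            (hy (2 * r) (by positivity))
          rw [mem_closedBall, dist_comm] at hyx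
          linarith
      _ ≤ ENNReal.ofReal (r ^ s) := by
          rw [← ENNReal.ofReal_mul hc.le]
          refine ENNReal.ofReal_le_ofReal ?_
          rw [Real.mul_rpow (by norm_num) hr.le, inv_mul_le_iff₀ (by positivity)]
          have : 0 ≤ (2 : ℝ) ^ s * r ^ s := by positivity
          nlinarith

/-! ### Upper bound for the dimension of fibres. -/

lemma volume_le_ediam_pow {m : ℕ} (S : Set (Eucl m)) (hS : ediam S ≠ ⊤) :
    volume S ≤ volume (ball (0 : Eucl m) 1) * ⨆ _ : S.Nonempty, ediam S ^ (m : ℝ) := by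
  rcases S.eq_empty_or_nonempty with rfl | hne
  · simp
  obtain ⟨x, hx⟩ := hne
  have hsub : S ⊆ closedBall x (ediam S).toReal := by
    intro y hy
    rw [mem_closedBall, dist_edist]
    exact ENNReal.toReal_mono hS (edist_le_ediam_of_mem hy hx)
  refine (measure_mono hsub).trans ?_
  rw [addHaar_closedBall volume x ENNReal.toReal_nonneg, finrank_euclideanSpace_fin,
    ENNReal.ofReal_pow ENNReal.toReal_nonneg, ENNReal.ofReal_toReal hS, mul_comm,
    ciSup_pos ⟨x, hx⟩, ENNReal.rpow_natCast]

/-- Almost all fibers of a set of finite `s`-dimensional measure under a `1`-Lipschitz map to `ℝᵐ`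
have finite `(s - m)`-dimensional measure. -/
lemma ae_hausdorffMeasure_fiber_ne_top {n m : ℕ} {s : ℝ} (hs : (m : ℝ) < s)
    {p : Eucl n → Eucl m} (hp : LipschitzWith 1 p) {A : Set (Eucl n)}
    (hA : (μH[s] : Measure (Eucl n)) A < ⊤) :
    ∀ᵐ u, (μH[s - m] : Measure (Eucl n)) (p ⁻¹' {u} ∩ A) ≠ ⊤ := by
  have hsm : 0 < s - m := sub_pos.2 hs
  set H := (μH[s] : Measure (Eucl n)) A with hH
  let δ : ℕ → ℝ≥0∞ := fun k => ((k : ℝ≥0∞) + 1)⁻¹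
  have hδ1 : ∀ k, δ k ≠ ⊤ := fun k => by simp [δ]
  have hcov : ∀ k, ∃ T : ℕ → Set (Eucl n), A ⊆ ⋃ i, T i ∧ (∀ i, ediam (T i) ≤ δ k) ∧
      ∑' i, ⨆ _ : (T i).Nonempty, ediam (T i) ^ s ≤ H + 1 := by
    intro k
    have h1 : (⨅ (T : ℕ → Set (Eucl n)) (_ : A ⊆ ⋃ i, T i) (_ : ∀ i, ediam (T i) ≤ δ k),
        ∑' i, ⨆ _ : (T i).Nonempty, ediam (T i) ^ s) < H + 1 := by
      refine lt_of_le_of_lt ?_ (ENNReal.lt_add_right hA.ne one_ne_zero)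
      rw [hH, hausdorffMeasure_apply]
      exact le_iSup₂_of_le (δ k) (by simp [δ]) le_rfl
    simp only [iInf_lt_iff] at h1
    obtain ⟨T, h2, h3, h4⟩ := h1
    exact ⟨T, h2, h3, h4.le⟩
  choose T hT hTδ hTs using hcov
  -- This bounds the covering sum of the fibre over `u`. Closures make it measurable without
  -- increasing diameters.
  let g : ℕ → Eucl m → ℝ≥0∞ := fun k u =>
    ∑' i, (closure (p '' T k i)).indicator (fun _ => ediam (T k i) ^ (s - m)) u
  have hgm : ∀ k, Measurable (g k) := fun k =>
    Measurable.tsum fun i => measurable_const.indicator isClosed_closure.measurableSet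
  have hpd : ∀ k i, ediam (closure (p '' T k i)) ≤ ediam (T k i) := by
    intro k i
    rw [ediam_closure]
    simpa using hp.ediam_image_le (T k i)
  have hgint : ∀ k, ∫⁻ u, g k u ≤ volume (ball (0 : Eucl m) 1) * (H + 1) := by
    intro k
    rw [lintegral_tsum fun i =>
      (measurable_const.indicator isClosed_closure.measurableSet).aemeasurable]
    calc ∑' i, ∫⁻ u, (closure (p '' T k i)).indicator (fun _ => ediam (T k i) ^ (s - m)) u
        ≤ ∑' i, volume (ball (0 : Eucl m) 1) * ⨆ _ : (T k i).Nonempty, ediam (T k i) ^ s := by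
          refine ENNReal.tsum_le_tsum fun i => ?_
          rw [lintegral_indicator_const isClosed_closure.measurableSet]
          rcases (T k i).eq_empty_or_nonempty with h | h
          · simp [h]
          have h1 := volume_le_ediam_pow (closure (p '' T k i))
            (ne_top_of_le_ne_top (hδ1 k) ((hpd k i).trans (hTδ k i)))
          rw [ciSup_pos (h.image p).closure] at h1
          rw [ciSup_pos h]
          calc ediam (T k i) ^ (s - m) * volume (closure (p '' T k i))
              ≤ ediam (T k i) ^ (s - m) *
                (volume (ball (0 : Eucl m) 1) * ediam (T k i) ^ (m : ℝ)) := by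
                gcongr
                refine h1.trans ?_
                gcongr
                exact hpd k i
            _ = volume (ball (0 : Eucl m) 1) *
                (ediam (T k i) ^ (s - m) * ediam (T k i) ^ (m : ℝ)) := by ring
            _ = _ := by
                rw [← ENNReal.rpow_add_of_nonneg _ _ hsm.le (Nat.cast_nonneg m), sub_add_cancel]
      _ ≤ _ := by
          rw [ENNReal.tsum_mul_left]
          gcongr
          exact hTs k
  -- Fatou's lemma passes the uniform integral bound to the limit of finer covers.
  have hlim : ∫⁻ u, liminf (fun k => g k u) atTop ≠ ⊤ := by
    refine ne_top_of_le_ne_top ?_ ((lintegral_liminf_le hgm).trans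
      ((liminf_le_liminf (Eventually.of_forall hgint)).trans (liminf_const _).le))
    exact ENNReal.mul_ne_top measure_ball_lt_top.ne
      (ENNReal.add_ne_top.2 ⟨hA.ne, ENNReal.one_ne_top⟩)
  have hδ0 : Tendsto δ atTop (𝓝 0) := by
    have := (tendsto_add_atTop_iff_nat (f := fun k : ℕ => ((k : ℝ≥0∞))⁻¹) 1).2
      ENNReal.tendsto_inv_nat_nhds_zero
    simpa [δ] using this
  filter_upwards [ae_lt_top (Measurable.liminf hgm) hlim] with u hu
  refine ne_top_of_le_ne_top hu.ne ?_
  refine (hausdorffMeasure_le_liminf_tsum (s - m) (p ⁻¹' {u} ∩ A) δ hδ0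
    (fun k i => p ⁻¹' {u} ∩ T k i)
    (Eventually.of_forall fun k i => (ediam_mono inter_subset_right).trans (hTδ k i))
    (Eventually.of_forall fun k => ?_)).trans (liminf_le_liminf (Eventually.of_forall fun k => ?_))
  · rw [← inter_iUnion]
    exact inter_subset_inter_right _ (hT k)
  · refine ENNReal.tsum_le_tsum fun i => ?_
    rcases (p ⁻¹' {u} ∩ T k i).eq_empty_or_nonempty with h | ⟨y, hyu, hy⟩
    · simp [h, hsm]
    · have : u ∈ closure (p '' T k i) := subset_closure ⟨y, hy, hyu⟩
      rw [indicator_of_mem this]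
      gcongr
      exact inter_subset_right

/-! ### Combining both bounds. -/

theorem mainTheorem2 (n m : ℕ) (s : ℝ) (hs : (m : ℝ) < s)
    {Λ : Type*} [MetricSpace Λ] [CompactSpace Λ] [MeasurableSpace Λ] [BorelSpace Λ]
    (ω : Measure Λ) [IsFiniteMeasure ω] (hω : ω ≠ 0)
    (P : Λ → Eucl n → Eucl m) (hP : ∀ l, IsOrthProj (P l))
    (hPc : ∀ x, Continuous fun l => P l x)
    (hL2 : ∃ C : ℝ, 0 < C ∧ ∀ μ : Measure (Eucl n),
      MemM (Metric.closedBall 0 1) μ → IsFrostman s μ →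
        (∀ᵐ l ∂ω, μ.map (P l) ≪ volume) ∧
        ∫⁻ l, (∫⁻ u, ((μ.map (P l)).rnDeriv volume u) ^ 2 ∂volume) ∂ω
          < ENNReal.ofReal C * μ (Metric.closedBall 0 1))
    (A : Set (Eucl n)) (hA : (μH[s] : Measure (Eucl n)).toOuterMeasure.IsCaratheodory A)
    (hA0 : 0 < (μH[s] : Measure (Eucl n)) A) (hAfin : (μH[s] : Measure (Eucl n)) A < ⊤) :
    ∀ᵐ l ∂ω, 0 < volume {u : Eucl m | dimH (P l ⁻¹' {u} ∩ A) = ENNReal.ofReal (s - m)} := by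
  obtain ⟨C, -, hC⟩ := hL2
  have hsm : 0 < s - m := sub_pos.2 hs
  obtain ⟨F, μ, hFA, hFm, hfin, hμ0, hμF, hFr⟩ := exists_isFrostman_of_isCaratheodory
    (lt_of_le_of_lt (Nat.cast_nonneg m) hs) hA hA0 hAfin
  have hLip : ∀ l, LipschitzWith 1 (P l) := fun l =>
    (hP l).exists_continuousLinearMap.choose_spec.2
  have hPm : Measurable fun q : Λ × Eucl n => P q.1 q.2 :=
    (continuous_prod_of_continuous_lipschitzWith' (fun q : Λ × Eucl n => P q.1 q.2) 1
      hLip hPc).measurable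
  -- A sequence increasing to `s - m` leaves only countably many exceptional `ω`-null sets.
  obtain ⟨t, -, ht, htlim⟩ := exists_seq_strictMono_tendsto' hsm
  filter_upwards [ae_all_iff.2 fun j =>
    ae_absolutelyContinuous_and_energy hP hPm hC μ hFr (ht j).2] with l hl
  have hPl : Measurable (P l) := (hLip l).continuous.measurable
  have hac : μ.map (P l) ≪ volume := (hl 0).1
  have hlow : ∀ᵐ u ∂(μ.map (P l)), ∀ j, ENNReal.ofReal (t j) ≤ dimH (P l ⁻¹' {u} ∩ F) :=
    ae_all_iff.2 fun j => ae_le_dimH_fiber (ht j).1 μ hPl hac hμF hFm (hl j).2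
  have hdim : ∀ᵐ u ∂(μ.map (P l)), dimH (P l ⁻¹' {u} ∩ A) = ENNReal.ofReal (s - m) := by
    filter_upwards [hlow, hac.ae_le (ae_hausdorffMeasure_fiber_ne_top hs (hLip l) hAfin)]
      with u h1 h2
    refine le_antisymm ?_ ?_
    · refine dimH_le_of_hausdorffMeasure_ne_top (d := (s - m).toNNReal) ?_
      rwa [Real.coe_toNNReal _ hsm.le]
    · exact (le_of_tendsto' (ENNReal.tendsto_ofReal htlim) h1).trans
        (dimH_mono (inter_subset_inter_right _ hFA))
  -- No measurability of the set of good `u` is needed: if it were Lebesgue-null, it would be null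
  -- for the push-forward, yet almost every `u` is good.
  refine pos_iff_ne_zero.2 fun h0 => hμ0 ?_
  have hfalse : ∀ᵐ u ∂(μ.map (P l)), False := by
    filter_upwards [hdim, measure_eq_zero_iff_ae_notMem.1 (hac h0)] with u h1 h2
    exact h2 h1
  rw [eventually_false_iff_eq_bot, ae_eq_bot] at hfalse
  exact (Measure.map_eq_zero_iff hPl.aemeasurable).1 hfalse
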